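/- All linear orders are strict total orders (possibly empty). A subset $A$ of a linear order $L$ is convex if every element of $L\setminus A$ lies either strictly below all elements of $A$ or strictly above all elements of $A$; a convex embedding is a strictly increasing map between linear orders with convex image, and two linear orders are convex-biembeddable if each admits a convex embedding into the other. For a non-empty countable set $S$ of linear orders, call $\chi:\mathbb{Q}\to S$ a dense colouring if for every $s\in S$ and all rationals $x<x'$ there is $y\in\mathbb{Q}$ with $x<y<x'$ and $\chi(y)=s$. The shuffle $\Xi(S)$ is the ordered sum $\sum_{q\in\mathbb{Q}}\chi(q)$, i.e. the set of pairs $(q,a)$ with $q\in\mathbb{Q}$ and $a\in\chi(q)$ ordered lexicographically, for a dense colouring $\chi:\mathbb{Q}\to S$ (up to isomorphism it does not depend on the choice of $\chi$). Theorem. Let $L_+$ and $L_-$ be convex-biembeddable countable linear orders, and suppose that there are countable sets $S_+$ and $S_-$ of linear orders such that $L_+\cong\Xi(S_+)$ and $L_-\cong\Xi(S_-)$. Then $L_+\cong L_-$. -/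

import Mathlib

universe u v w z

namespace CSBShuffle

/-- A convex embedding of linear orders: a strictly increasing map (equivalently, an embedding of
linear orders) whose image is a convex subset of the codomain. -/
def IsConvexEmbedding {L : Type u} {M : Type v} [LinearOrder L] [LinearOrder M] (f : L → M) :
    Prop :=
  StrictMono f ∧ (Set.range f).OrdConnected

/-- Two linear orders are convex-biembeddable if each has a convex embedding into the other. -/
def ConvexBiembeddable (L : Type u) (M : Type v) [LinearOrder L] [LinearOrder M] : Prop :=
  (∃ f : L → M, IsConvexEmbedding f) ∧ ∃ g : M → L, IsConvexEmbedding g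

/-- A colouring `χ` of a linear order is dense if every colour occurs strictly between any two
points `x < x'`. -/
def IsDenseColoring {L : Type u} {C : Type v} [LinearOrder L] (χ : L → C) : Prop :=
  ∀ c : C, ∀ x x' : L, x < x' → ∃ y : L, x < y ∧ y < x' ∧ χ y = c

/-- The ordered sum `∑_{x ∈ L} χ(x)` of linear orders along a linear order `L`: the set of pairs
`(x, y)` with `x ∈ L` and `y ∈ χ(x)`, ordered lexicographically. -/
abbrev OrderedSum (L : Type u) [LinearOrder L] (S : Set LinOrd.{w}) (χ : L → S) : Type (max u w) :=
  Σₗ x : L, ((χ x : LinOrd.{w}) : Type w)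

/-- `L ≅ Ξ(S)`: the linear order `L` is isomorphic to the ordered sum over the rationals of a dense
`S`-colouring of the rationals. -/
def IsShuffleOf (L : Type u) [LinearOrder L] (S : Set LinOrd.{w}) : Prop :=
  ∃ χ : ℚ → S, IsDenseColoring χ ∧ Nonempty (L ≃o OrderedSum ℚ S χ)

end CSBShuffle

/-!
Call an order *absorbing* if it has convex copies of itself below and above each of its points.
A shuffle is absorbing: by back-and-forth, a dense colouring of `ℚ` is isomorphic to its
restriction to every open interval.

In an absorbing order, collapse `x` and `y` when no interval between them contains a convex copy of
the whole order. The classes are convex and form a dense order without endpoints. A convex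
embedding between biembeddable absorbing orders maps each class onto a class, and every interval
that is not collapsed contains a copy of either order. So the class of any point of one order occurs
up to isomorphism between any two classes of the other. A second back-and-forth matches
isomorphic classes, and the isomorphisms between them glue together.
-/

namespace CSBShuffle

open Set

section BackAndForth

variable {α β : Type*}

/-- A relation between the points of `α` and those of an order `β` such that every point of
`α` is related to some point of each open interval of `β`. This plays the role of a dense colouring
of `β` by `α` when colours are only compared, not named. -/
def IsDenseRelation [Preorder β] (R : α → β → Prop) : Prop :=
  ∀ a x y, x < y → ∃ b ∈ Ioo x y, R a b

theorem IsDenseRelation.exists_cmp_eq [LinearOrder β] [DenselyOrdered β] [NoMinOrder β]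
    [NoMaxOrder β] {R : α → β → Prop} (hR : IsDenseRelation R) (a : α) {s : Finset β} {b₀ : β}
    (hb₀ : b₀ ∉ s) : ∃ b, R a b ∧ ∀ x ∈ s, cmp x b = cmp x b₀ := by
  have : Nonempty β := ⟨b₀⟩
  obtain ⟨l, hl, hlb⟩ := Order.exists_between_finsets {x ∈ s | x < b₀} {b₀} (by simp)
  obtain ⟨u, hub, hu⟩ := Order.exists_between_finsets {b₀} {x ∈ s | b₀ < x} (by simp)
  simp only [Finset.mem_singleton, forall_eq, Finset.mem_filter, and_imp] at hl hlb hub hu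
  obtain ⟨b, ⟨hlb', hbu⟩, hab⟩ := hR a l u (hlb.trans hub)
  refine ⟨b, hab, fun x hx ↦ ?_⟩
  rcases lt_or_gt_of_ne (ne_of_mem_of_not_mem hx hb₀) with h | h
  · rw [h.cmp_eq_lt, ((hl x hx h).trans hlb').cmp_eq_lt]
  · rw [h.cmp_eq_gt, (hbu.trans (hu x hx h)).cmp_eq_gt]

variable [LinearOrder α] [LinearOrder β]

/-- A finite partial isomorphism whose pairs all satisfy `R`: a condition of the back-and-forth
construction of an isomorphism with graph contained in `R`. -/
abbrev PartialIsoIn (R : α → β → Prop) : Type _ :=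
  {f : Order.PartialIso α β // ∀ p ∈ f.val, R p.1 p.2}

namespace PartialIsoIn

variable {R : α → β → Prop}

theorem exists_cmp_eq [DenselyOrdered β] [NoMinOrder β] [NoMaxOrder β] [Nonempty β]
    (hR : IsDenseRelation R) (f : PartialIsoIn R) (a : α) :
    ∃ b, R a b ∧ ∀ p ∈ f.val.val, cmp p.1 a = cmp p.2 b := by
  classical
  by_cases ha : ∃ b, (a, b) ∈ f.val.val
  · obtain ⟨b, hb⟩ := ha
    exact ⟨b, f.prop _ hb, fun p hp ↦ f.val.prop _ hp _ hb⟩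
  obtain ⟨b₀, hb₀⟩ := f.val.exists_across a
  have hb₀_notMem : b₀ ∉ f.val.val.image Prod.snd := by
    rw [Finset.mem_image]
    rintro ⟨p, hp, rfl⟩
    obtain rfl : p.1 = a := (cmp_eq_eq_iff _ _).1 ((hb₀ p hp).trans (cmp_self_eq_eq _))
    exact ha ⟨p.2, hp⟩
  obtain ⟨b, hab, hb⟩ := hR.exists_cmp_eq a hb₀_notMem
  exact ⟨b, hab, fun p hp ↦ (hb₀ p hp).trans (hb _ (Finset.mem_image_of_mem _ hp)).symm⟩

theorem exists_ge_mem_left [DenselyOrdered β] [NoMinOrder β] [NoMaxOrder β] [Nonempty β]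
    (hR : IsDenseRelation R) (f : PartialIsoIn R) (a : α) :
    ∃ g ≥ f, ∃ b, (a, b) ∈ g.val.val := by
  classical
  obtain ⟨b, hab, hb⟩ := f.exists_cmp_eq hR a
  refine ⟨⟨⟨insert (a, b) f.val.val, ?_⟩, ?_⟩, Finset.subset_insert _ _,
    b, Finset.mem_insert_self _ _⟩
  · simp only [Finset.forall_mem_insert, cmp_self_eq_eq, true_and]
    exact ⟨fun q hq ↦ cmp_eq_cmp_symm.1 (hb q hq), fun p hp ↦ ⟨hb p hp, f.val.prop p hp⟩⟩
  · exact (Finset.forall_mem_insert _ _ _).2 ⟨hab, f.prop⟩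

theorem exists_flip (f : PartialIsoIn R) :
    ∃ g : PartialIsoIn (flip R), ∀ a b, (b, a) ∈ g.val.val ↔ (a, b) ∈ f.val.val := by
  have hmem : ∀ a b, (b, a) ∈ f.val.comm.val ↔ (a, b) ∈ f.val.val := fun a b ↦ by
    simp [Order.PartialIso.comm, Subtype.map]
  exact ⟨⟨f.val.comm, fun p hp ↦ f.prop (p.2, p.1) ((hmem _ _).1 hp)⟩, hmem⟩

theorem exists_ge_mem_right [DenselyOrdered α] [NoMinOrder α] [NoMaxOrder α] [Nonempty α]
    (hR : IsDenseRelation (flip R)) (f : PartialIsoIn R) (b : β) :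
    ∃ g ≥ f, ∃ a, (a, b) ∈ g.val.val := by
  obtain ⟨f', hf'⟩ := f.exists_flip
  obtain ⟨g', hle, a, ha⟩ := f'.exists_ge_mem_left hR b
  obtain ⟨g, hg⟩ := g'.exists_flip
  exact ⟨g, fun p hp ↦ (hg p.2 p.1).2 (hle ((hf' p.1 p.2).2 hp)), a, (hg b a).2 ha⟩

end PartialIsoIn

theorem exists_orderIso_of_isDenseRelation [Countable α] [DenselyOrdered α] [NoMinOrder α]
    [NoMaxOrder α] [Nonempty α] [Countable β] [DenselyOrdered β] [NoMinOrder β] [NoMaxOrder β]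
    [Nonempty β] {R : α → β → Prop} (hR : IsDenseRelation R) (hR' : IsDenseRelation (flip R)) :
    ∃ e : α ≃o β, ∀ a, R a (e a) := by
  cases nonempty_encodable α
  cases nonempty_encodable β
  let defined : α ⊕ β → Order.Cofinal (PartialIsoIn R) := Sum.elim
    (fun a ↦ ⟨{f | ∃ b, (a, b) ∈ f.val.val}, fun f ↦
      let ⟨g, hle, hg⟩ := f.exists_ge_mem_left hR a; ⟨g, hg, hle⟩⟩)
    (fun b ↦ ⟨{f | ∃ a, (a, b) ∈ f.val.val}, fun f ↦
      let ⟨g, hle, hg⟩ := f.exists_ge_mem_right hR' b; ⟨g, hg, hle⟩⟩)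
  let I := Order.idealOfCofinals ⟨default, fun p hp ↦ absurd hp (Finset.notMem_empty p)⟩ defined
  have hleft : ∀ a, ∃ b, ∃ f ∈ I, (a, b) ∈ f.val.val := fun a ↦
    let ⟨f, ⟨b, hb⟩, hf⟩ := Order.cofinal_meets_idealOfCofinals _ defined (Sum.inl a)
    ⟨b, f, hf, hb⟩
  have hright : ∀ b, ∃ a, ∃ f ∈ I, (a, b) ∈ f.val.val := fun b ↦
    let ⟨f, ⟨a, ha⟩, hf⟩ := Order.cofinal_meets_idealOfCofinals _ defined (Sum.inr b)
    ⟨a, f, hf, ha⟩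
  choose F hF using hleft
  choose G hG using hright
  refine ⟨OrderIso.ofCmpEqCmp F G fun a b ↦ ?_, fun a ↦ ?_⟩
  · obtain ⟨f, hf, ha⟩ := hF a
    obtain ⟨g, hg, hb⟩ := hG b
    obtain ⟨m, -, hfm, hgm⟩ := I.directed f hf g hg
    exact m.val.prop _ (hfm ha) _ (hgm hb)
  · obtain ⟨f, -, ha⟩ := hF a
    exact f.prop _ ha

end BackAndForth

section ConvexEmbedding

variable {K M N : Type*} [LinearOrder K] [LinearOrder M] [LinearOrder N]

namespace IsConvexEmbedding

theorem of_orderIso (e : K ≃o M) : IsConvexEmbedding e :=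
  ⟨e.strictMono, e.surjective.range_eq ▸ ordConnected_univ⟩

protected theorem id : IsConvexEmbedding (id : K → K) :=
  of_orderIso (OrderIso.refl K)

theorem image_Icc {f : K → M} (hf : IsConvexEmbedding f) (x y : K) :
    f '' Icc x y = Icc (f x) (f y) :=
  (OrderEmbedding.ofStrictMono f hf.1).image_Icc hf.2 x y

theorem comp {g : M → N} {f : K → M} (hg : IsConvexEmbedding g) (hf : IsConvexEmbedding f) :
    IsConvexEmbedding (g ∘ f) := by
  refine ⟨hg.1.comp hf.1, ⟨?_⟩⟩
  rintro _ ⟨x, rfl⟩ _ ⟨y, rfl⟩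
  rw [Function.comp_apply, Function.comp_apply, ← hg.image_Icc, range_comp]
  exact image_mono (hf.2.out (mem_range_self x) (mem_range_self y))

theorem of_comp {g : M → N} {f : K → M} (hg : StrictMono g) (hgf : IsConvexEmbedding (g ∘ f)) :
    IsConvexEmbedding f := by
  refine ⟨fun x y hxy ↦ hg.lt_iff_lt.1 (hgf.1 hxy), ⟨?_⟩⟩
  rintro _ ⟨x, rfl⟩ _ ⟨y, rfl⟩ z ⟨hxz, hzy⟩
  obtain ⟨k, hk⟩ := hgf.2.out ⟨x, rfl⟩ ⟨y, rfl⟩ ⟨hg.monotone hxz, hg.monotone hzy⟩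
  exact ⟨k, hg.injective hk⟩

end IsConvexEmbedding

variable (K) in
/-- The subset `s` of a linear order contains the image of a convex embedding of `K`. -/
def HasConvexCopy (s : Set M) : Prop :=
  ∃ f : K → M, IsConvexEmbedding f ∧ ∀ k, f k ∈ s

namespace HasConvexCopy

theorem mono {s t : Set M} (h : HasConvexCopy K s) (hst : s ⊆ t) : HasConvexCopy K t :=
  let ⟨f, hf, hfs⟩ := h
  ⟨f, hf, fun k ↦ hst (hfs k)⟩

theorem comp {s : Set N} (h : HasConvexCopy M s) {f : K → M} (hf : IsConvexEmbedding f) :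
    HasConvexCopy K s :=
  let ⟨g, hg, hgs⟩ := h
  ⟨g ∘ f, hg.comp hf, fun k ↦ hgs (f k)⟩

theorem image_iff {f : M → N} (hf : IsConvexEmbedding f) {s : Set M} :
    HasConvexCopy K (f '' s) ↔ HasConvexCopy K s := by
  constructor
  · rintro ⟨g, hg, hgs⟩
    choose g' hg's hg' using hgs
    obtain rfl : f ∘ g' = g := funext hg'
    exact ⟨g', hg.of_comp hf.1, hg's⟩
  · rintro ⟨g, hg, hgs⟩
    exact ⟨f ∘ g, hf.comp hg, fun k ↦ mem_image_of_mem f (hgs k)⟩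

theorem Icc_iff {f : K → M} {g : M → K} (hf : IsConvexEmbedding f) (hg : IsConvexEmbedding g)
    {x y : K} : HasConvexCopy M (Icc (f x) (f y)) ↔ HasConvexCopy K (Icc x y) := by
  rw [← hf.image_Icc, image_iff hf]
  exact ⟨fun h ↦ h.comp hf, fun h ↦ h.comp hg⟩

end HasConvexCopy

/-- A linear order with convex copies of itself below and above each of its points. This is the
property of shuffles from which convex-biembeddability gives an isomorphism. -/
class Absorbing (K : Type*) [LinearOrder K] : Prop where
  hasConvexCopy_Iio (z : K) : HasConvexCopy K (Iio z)
  hasConvexCopy_Ioi (z : K) : HasConvexCopy K (Ioi z)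

theorem Absorbing.of_orderIso [Absorbing M] (e : K ≃o M) : Absorbing K := by
  have hcopy {s : Set K} (h : HasConvexCopy M (e '' s)) : HasConvexCopy K s :=
    (HasConvexCopy.image_iff (.of_orderIso e)).1 (h.comp (.of_orderIso e))
  refine ⟨fun z ↦ hcopy ?_, fun z ↦ hcopy ?_⟩
  · exact e.image_Iio z ▸ hasConvexCopy_Iio (e z)
  · exact e.image_Ioi z ▸ hasConvexCopy_Ioi (e z)

end ConvexEmbedding

section Shuffle

theorem sigmaLex_fst_mono {ι : Type*} [Preorder ι] {A : ι → Type*} [∀ i, Preorder (A i)] :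
    Monotone (fun z : Σₗ i, A i ↦ z.1) := fun _ _ h ↦
  (Sigma.Lex.le_def.1 h).elim le_of_lt fun ⟨h, _⟩ ↦ h.le

theorem isConvexEmbedding_sigmaLex {ι κ : Type*} [LinearOrder ι] [LinearOrder κ]
    {A : ι → Type*} {B : κ → Type*} [∀ i, LinearOrder (A i)] [∀ k, LinearOrder (B k)]
    {φ : ι → κ} (hφ : IsConvexEmbedding φ) (e : ∀ i, A i ≃o B (φ i)) :
    IsConvexEmbedding (fun z : Σₗ i, A i ↦ (toLex ⟨φ z.1, e z.1 z.2⟩ : Σₗ k, B k)) := by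
  refine ⟨?_, ⟨?_⟩⟩
  · rintro ⟨i, a⟩ ⟨j, b⟩ h
    rcases Sigma.Lex.lt_def.1 h with h | ⟨hij, h⟩
    · exact Sigma.Lex.lt_def.2 (Or.inl (hφ.1 h))
    · obtain rfl : i = j := hij
      exact Sigma.Lex.lt_def.2 (Or.inr ⟨rfl, (e i).strictMono h⟩)
  · rintro _ ⟨z, rfl⟩ _ ⟨w, rfl⟩ ⟨k, c⟩ ⟨hz, hw⟩
    obtain ⟨i, rfl⟩ := hφ.2.out ⟨z.1, rfl⟩ ⟨w.1, rfl⟩ ⟨sigmaLex_fst_mono hz, sigmaLex_fst_mono hw⟩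
    exact ⟨toLex ⟨i, (e i).symm c⟩, congrArg (Sigma.mk (φ i)) ((e i).apply_symm_apply c)⟩

variable {Q : Type*} [LinearOrder Q] [Countable Q] [DenselyOrdered Q] [NoMinOrder Q]
  [NoMaxOrder Q] [Nonempty Q]

theorem IsDenseColoring.exists_isConvexEmbedding {C : Type*} {χ : Q → C}
    (hχ : IsDenseColoring χ) (I : Set Q) [I.OrdConnected] [Nonempty I] [NoMinOrder I]
    [NoMaxOrder I] :
    ∃ φ : Q → Q, IsConvexEmbedding φ ∧ (∀ q, φ q ∈ I) ∧ ∀ q, χ q = χ (φ q) := by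
  have hQI : IsDenseRelation fun (q : Q) (i : I) ↦ χ q = χ i := fun q x y hxy ↦ by
    obtain ⟨b, hxb, hby, hb⟩ := hχ (χ q) x y hxy
    exact ⟨⟨b, OrdConnected.out ‹_› x.2 y.2 ⟨hxb.le, hby.le⟩⟩, ⟨hxb, hby⟩, hb.symm⟩
  have hIQ : IsDenseRelation (flip fun (q : Q) (i : I) ↦ χ q = χ i) := fun i x y hxy ↦ by
    obtain ⟨b, hxb, hby, hb⟩ := hχ (χ i) x y hxy
    exact ⟨b, ⟨hxb, hby⟩, hb⟩
  obtain ⟨e, he⟩ := exists_orderIso_of_isDenseRelation hQI hIQ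
  have hval : IsConvexEmbedding ((↑) : I → Q) :=
    ⟨Subtype.strictMono_coe _, by rwa [Subtype.range_coe]⟩
  exact ⟨_, hval.comp (.of_orderIso e), fun q ↦ (e q).2, he⟩

theorem IsDenseColoring.hasConvexCopy_preimage_fst {S : Set LinOrd} {χ : Q → S}
    (hχ : IsDenseColoring χ) (I : Set Q) [I.OrdConnected] [Nonempty I] [NoMinOrder I]
    [NoMaxOrder I] :
    HasConvexCopy (OrderedSum Q S χ) {z : OrderedSum Q S χ | z.1 ∈ I} := by
  obtain ⟨φ, hφ, hφI, hχφ⟩ := hχ.exists_isConvexEmbedding I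
  exact ⟨_, isConvexEmbedding_sigmaLex hφ fun q ↦ hχφ q ▸ OrderIso.refl _, fun z ↦ hφI z.1⟩

theorem IsDenseColoring.absorbing_orderedSum {S : Set LinOrd} {χ : Q → S}
    (hχ : IsDenseColoring χ) : Absorbing (OrderedSum Q S χ) where
  hasConvexCopy_Iio z := (hχ.hasConvexCopy_preimage_fst (Iio z.1)).mono fun _ h ↦
    Sigma.Lex.lt_def.2 (Or.inl h)
  hasConvexCopy_Ioi z := (hχ.hasConvexCopy_preimage_fst (Ioi z.1)).mono fun _ h ↦
    Sigma.Lex.lt_def.2 (Or.inl h)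

theorem IsShuffleOf.absorbing {L : Type*} [LinearOrder L] {S : Set LinOrd}
    (h : IsShuffleOf L S) : Absorbing L :=
  let ⟨_, hχ, ⟨e⟩⟩ := h
  have := hχ.absorbing_orderedSum
  .of_orderIso e

end Shuffle

section Absorbing

variable {K M : Type*} [LinearOrder K] [LinearOrder M] [Absorbing K]

theorem HasConvexCopy.Icc_of_forall_le {f : K → M} (hf : IsConvexEmbedding f) {b : M}
    (hb : ∀ k, b ≤ f k) (a : K) : HasConvexCopy K (Icc b (f a)) :=
  ((image_iff hf).2 (Absorbing.hasConvexCopy_Iio a)).mono <|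
    image_subset_iff.2 fun k hk ↦ ⟨hb k, (hf.1 hk).le⟩

theorem HasConvexCopy.Icc_of_forall_ge {f : K → M} (hf : IsConvexEmbedding f) {b : M}
    (hb : ∀ k, f k ≤ b) (a : K) : HasConvexCopy K (Icc (f a) b) :=
  ((image_iff hf).2 (Absorbing.hasConvexCopy_Ioi a)).mono <|
    image_subset_iff.2 fun k hk ↦ ⟨(hf.1 hk).le, hb k⟩

theorem HasConvexCopy.Icc_or_Icc {x z : K} (h : HasConvexCopy K (Icc x z)) (y : K) :
    HasConvexCopy K (Icc x y) ∨ HasConvexCopy K (Icc y z) := by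
  obtain ⟨f, hf, hfxz⟩ := h
  rcases le_total (f y) y with hy | hy
  · exact Or.inl ((Icc_of_forall_le hf (fun k ↦ (hfxz k).1) y).mono (Icc_subset_Icc_right hy))
  · exact Or.inr ((Icc_of_forall_ge hf (fun k ↦ (hfxz k).2) y).mono (Icc_subset_Icc_left hy))

theorem HasConvexCopy.lt_of_Icc {x y : K} (h : HasConvexCopy K (Icc x y)) : x < y := by
  obtain ⟨f, hf, hfxy⟩ := h
  obtain ⟨g, -, hg⟩ := Absorbing.hasConvexCopy_Ioi x
  exact (hfxy x).1.trans_lt ((hf.1 (hg x)).trans_le (hfxy _).2)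

/-- Type synonym carrying the total preorder whose strict part relates `x` to `y` when `Icc x y`
contains a convex copy of `K`; its antisymmetrization is the condensation of `K`. -/
def CondensationOrder (K : Type*) := K

instance : Preorder (CondensationOrder K) where
  le x y := ¬ HasConvexCopy K (Icc (α := K) y x)
  lt x y := HasConvexCopy K (Icc (α := K) x y)
  le_refl _ h := h.lt_of_Icc.false
  le_trans _ y _ hxy hyz h := (h.Icc_or_Icc y).elim hyz hxy
  lt_iff_le_not_ge _ _ :=
    ⟨fun h ↦ ⟨fun h' ↦ h.lt_of_Icc.asymm h'.lt_of_Icc, not_not.2 h⟩, fun h ↦ not_not.1 h.2⟩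

instance : @Std.Total (CondensationOrder K) (· ≤ ·) where
  total _ _ := not_and_or.1 fun h ↦ h.1.lt_of_Icc.asymm h.2.lt_of_Icc

/-- The condensation of an absorbing order: its quotient by the relation that no interval between
the two points contains a convex copy of the whole order. -/
def Condensation (K : Type*) [LinearOrder K] [Absorbing K] : Type _ :=
  Antisymmetrization (CondensationOrder K) (· ≤ ·)

namespace Condensation

open Classical in
noncomputable instance : LinearOrder (Condensation K) :=
  inferInstanceAs (LinearOrder (Antisymmetrization (CondensationOrder K) (· ≤ ·)))

/-- The class of a point in the condensation. -/
def mk (x : K) : Condensation K :=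
  toAntisymmetrization (α := CondensationOrder K) (· ≤ ·) x

theorem mk_surjective : Function.Surjective (mk : K → Condensation K) :=
  Quotient.mk_surjective

theorem mk_lt_mk {x y : K} : mk x < mk y ↔ HasConvexCopy K (Icc x y) :=
  Iff.rfl

theorem mk_mono : Monotone (mk : K → Condensation K) := fun _ _ hxy ↦
  not_lt.1 fun h ↦ (mk_lt_mk.1 h).lt_of_Icc.not_ge hxy

instance [Countable K] : Countable (Condensation K) :=
  mk_surjective.countable

instance [Nonempty K] : Nonempty (Condensation K) :=
  ‹Nonempty K›.map mk

end Condensation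

end Absorbing

section Fibers

open Condensation

theorem nonempty_orderIso_of_fibers {K M ι κ : Type*} [LinearOrder K] [LinearOrder M]
    [PartialOrder ι] [PartialOrder κ] {π : K → ι} {ρ : M → κ} (hπ : Monotone π) (hρ : Monotone ρ)
    (φ : ι ≃o κ) (h : ∀ i, Nonempty (π ⁻¹' {i} ≃o ρ ⁻¹' {φ i})) : Nonempty (K ≃o M) := by
  let e i := (h i).some
  let F (x : K) : M := e (π x) ⟨x, rfl⟩
  have hF : ∀ i (x : π ⁻¹' {i}), F x = e i x := by
    rintro _ ⟨x, rfl⟩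
    rfl
  have hρF : ∀ x, ρ (F x) = φ (π x) := fun x ↦ (e (π x) ⟨x, rfl⟩).2
  have hmono : StrictMono F := fun x y hxy ↦ by
    rcases (hπ hxy.le).eq_or_lt with hπxy | hπxy
    · rw [hF (π y) ⟨x, hπxy⟩, hF (π y) ⟨y, rfl⟩]
      exact (e (π y)).strictMono hxy
    · exact hρ.reflect_lt (by simpa only [hρF] using φ.strictMono hπxy)
  have hsurj : Function.Surjective F := fun y ↦ by
    obtain ⟨i, hi⟩ := φ.surjective (ρ y)
    refine ⟨(e i).symm ⟨y, hi.symm⟩, ?_⟩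
    rw [hF i, OrderIso.apply_symm_apply]
  exact ⟨hmono.orderIsoOfSurjective F hsurj⟩

variable {K M : Type*} [LinearOrder K] [LinearOrder M] [Absorbing K] [Absorbing M]

namespace IsConvexEmbedding

variable {f : K → M} {g : M → K}

theorem condensationMk_eq_iff (hf : IsConvexEmbedding f) (hg : IsConvexEmbedding g) {x y : K} :
    mk (f x) = mk (f y) ↔ mk x = mk y := by
  simp only [le_antisymm_iff, ← not_lt, mk_lt_mk, HasConvexCopy.Icc_iff hf hg]

theorem countable_condensation [Countable (Condensation M)] (hf : IsConvexEmbedding f)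
    (hg : IsConvexEmbedding g) : Countable (Condensation K) := by
  let out : Condensation K → K := Function.surjInv mk_surjective
  refine Function.Injective.countable (f := fun c ↦ mk (f (out c))) fun c d hcd ↦ ?_
  rw [← Function.surjInv_eq mk_surjective c, ← Function.surjInv_eq mk_surjective d]
  exact (hf.condensationMk_eq_iff hg).1 hcd

theorem mem_range_of_condensationMk_eq (hf : IsConvexEmbedding f) (hg : IsConvexEmbedding g)
    {a : K} {y : M} (hy : mk y = mk (f a)) : y ∈ range f := by
  rw [← hf.2.upperClosure_inter_lowerClosure]
  simp only [mem_inter_iff, SetLike.mem_coe, mem_upperClosure, mem_lowerClosure, exists_range_iff]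
  constructor
  · by_contra! h
    exact hy.not_lt (mk_lt_mk.2 ((HasConvexCopy.Icc_of_forall_le hf (fun k ↦ (h k).le) a).comp hg))
  · by_contra! h
    exact hy.not_gt (mk_lt_mk.2 ((HasConvexCopy.Icc_of_forall_ge hf (fun k ↦ (h k).le) a).comp hg))

theorem nonempty_orderIso_fiber (hf : IsConvexEmbedding f) (hg : IsConvexEmbedding g) (a : K) :
    Nonempty ((mk ⁻¹' {mk a} : Set K) ≃o (mk ⁻¹' {mk (f a)} : Set M)) := by
  have hmaps : MapsTo f (mk ⁻¹' {mk a}) (mk ⁻¹' {mk (f a)}) := fun x hx ↦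
    (hf.condensationMk_eq_iff hg).2 hx
  refine ⟨StrictMono.orderIsoOfSurjective hmaps.restrict (fun x y hxy ↦ hf.1 hxy) ?_⟩
  rintro ⟨y, hy⟩
  obtain ⟨x, rfl⟩ := hf.mem_range_of_condensationMk_eq hg hy
  exact ⟨⟨x, (hf.condensationMk_eq_iff hg).1 hy⟩, rfl⟩

theorem isDenseRelation_fiber (hf : IsConvexEmbedding f) (hg : IsConvexEmbedding g) :
    IsDenseRelation fun (a : Condensation K) (b : Condensation M) ↦
      Nonempty ((mk ⁻¹' {a} : Set K) ≃o (mk ⁻¹' {b} : Set M)) := by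
  intro a x y hxy
  obtain ⟨a, rfl⟩ := mk_surjective a
  obtain ⟨x, rfl⟩ := mk_surjective x
  obtain ⟨y, rfl⟩ := mk_surjective y
  obtain ⟨h, hh, hhxy⟩ := (mk_lt_mk.1 hxy).comp hf
  refine ⟨mk (h a), ⟨mk_lt_mk.2 ?_, mk_lt_mk.2 ?_⟩, hh.nonempty_orderIso_fiber hg a⟩
  · exact (HasConvexCopy.Icc_of_forall_le hh (fun k ↦ (hhxy k).1) a).comp hg
  · exact (HasConvexCopy.Icc_of_forall_ge hh (fun k ↦ (hhxy k).2) a).comp hg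

end IsConvexEmbedding

instance : DenselyOrdered (Condensation K) where
  dense a b hab :=
    let ⟨c, hc, _⟩ := IsConvexEmbedding.id.isDenseRelation_fiber IsConvexEmbedding.id a a b hab
    ⟨c, hc⟩

instance : NoMinOrder (Condensation K) where
  exists_lt a := by
    obtain ⟨z, rfl⟩ := mk_surjective a
    obtain ⟨f, hf, hfz⟩ := Absorbing.hasConvexCopy_Iio z
    exact ⟨mk (f z), mk_lt_mk.2 (HasConvexCopy.Icc_of_forall_ge hf (fun k ↦ (hfz k).le) z)⟩

instance : NoMaxOrder (Condensation K) where
  exists_gt a := by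
    obtain ⟨z, rfl⟩ := mk_surjective a
    obtain ⟨f, hf, hfz⟩ := Absorbing.hasConvexCopy_Ioi z
    exact ⟨mk (f z), mk_lt_mk.2 (HasConvexCopy.Icc_of_forall_le hf (fun k ↦ (hfz k).le) z)⟩

end Fibers

end CSBShuffle

open CSBShuffle in
theorem theorem1_general {K : Type u} {M : Type v} [LinearOrder K] [LinearOrder M] [Absorbing K]
    [Absorbing M] [Countable (Condensation K)] (h : ConvexBiembeddable K M) :
    Nonempty (K ≃o M) := by
  obtain ⟨⟨f, hf⟩, g, hg⟩ := h
  rcases isEmpty_or_nonempty K with hK | ⟨⟨a⟩⟩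
  · have : IsEmpty M := Function.isEmpty g
    exact ⟨OrderIso.ofIsEmpty K M⟩
  have : Nonempty K := ⟨a⟩
  have : Nonempty M := ⟨f a⟩
  have : Countable (Condensation M) := hg.countable_condensation hf
  obtain ⟨φ, hφ⟩ := exists_orderIso_of_isDenseRelation (hf.isDenseRelation_fiber hg)
    fun b x y hxy ↦ (hg.isDenseRelation_fiber hf b x y hxy).imp fun _ ⟨ha, e⟩ ↦
      ⟨ha, e.map OrderIso.symm⟩
  exact nonempty_orderIso_of_fibers Condensation.mk_mono Condensation.mk_mono φ hφ

theorem theorem1 (Lp : Type u) (Lm : Type v) [LinearOrder Lp] [LinearOrder Lm]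
    [Countable Lp] [Countable Lm]
    (hconv : CSBShuffle.ConvexBiembeddable Lp Lm)
    (hp : ∃ Sp : Set LinOrd.{w}, Sp.Countable ∧ CSBShuffle.IsShuffleOf Lp Sp)
    (hm : ∃ Sm : Set LinOrd.{z}, Sm.Countable ∧ CSBShuffle.IsShuffleOf Lm Sm) :
    Nonempty (Lp ≃o Lm) := by
  obtain ⟨_, _, hp⟩ := hp
  obtain ⟨_, _, hm⟩ := hm
  have := hp.absorbing
  have := hm.absorbing
  exact theorem1_general hconv
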